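/- Let $\mathbb F_q$ be a finite field with $q$ elements, $K$ a perfect field containing $\mathbb F_q$, $\ell:\mathbb F_q[t]\to K$ a homomorphism of $\mathbb F_q$-algebras, and $\theta=\ell(t)$. Let $K\{\tau\}$ be the ring of twisted polynomials over $K$, with $\tau a=a^q\tau$ for $a\in K$. A $t$-module $E$ over $K$ of dimension $d$, given in coordinates ($E=\mathbb G_a^d$), is a homomorphism of $\mathbb F_q$-algebras $\varphi:\mathbb F_q[t]\to M_d(K\{\tau\})$ such that, for every $a\in\mathbb F_q[t]$, the matrix $d\varphi_a-\ell(a)I_d$ is nilpotent, where $d\varphi_a\in M_d(K)$ is the constant coefficient of $\varphi_a$. Put $D=\varphi_t$. (i) $E$ is *almost strictly pure* (with respect to the given coordinates) if for some integer $s\ge1$ one has $D^s=A_0+A_1\tau+\dots+A_r\tau^r$ with $A_i\in M_d(K)$ and $A_r\in GL_d(K)$. (ii) The $t$-motive $M(E)$ is the free left $K\{\tau\}$-module with basis $\kappa_1,\dots,\kappa_d$ on which $t$ acts $K\{\tau\}$-linearly by $t\kappa_i=\sum_j D_{ij}\kappa_j$. $E$ is *abelian* if $M(E)$ is finitely generated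 over $K[t]$; its *weight* is then $d/\operatorname{rk}_{K[t]}M(E)$. $E$ is *pure* if it is abelian and there exist a $K[[1/t]]$-lattice $\Lambda$ in $K((1/t))\otimes_{K[t]}M(E)$ and integers $u,v\ge1$ with $t^u\Lambda=\tau^v\Lambda$, where $\tau$ acts by $\tau(f\otimes m)=f^{(1)}\otimes\tau m$ and $f^{(1)}$ is obtained from $f$ by raising its coefficients to the $q$-th power. **Theorem.** (a) If $K$ is not algebraic over $\mathbb F_q$ (for instance, if $\theta$ is transcendental over $\mathbb F_q$), then for every integer $d\ge2$ there is a $t$-module over $K$ of dimension $d$ (for the given $\ell$) that is pure but not almost strictly pure. So the converse of the theorem of Namoijam and Papanikolas, that almost strictly pure implies pure, fails. (b) Suppose that $\theta$ is transcendental over $\mathbb F_q$. For $d=2$ an example is the $t$-module with $$\varphi_t=D_2=\theta I_2+I_2\,\tau+\begin{pmatrix}0&0\\ \theta&0\end{pmatrix}\tau^2 .$$ It is pure of weight $1$ and not almost strictly pure, and for every $n\ge1$ the leading coefficient (in $\tau$) of $D_2^n$ is not invertible. For every $d>2$ an example is the $t$-module whose $\varphi_t$ is the block diagonal matrix with one block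 $D_2$ followed by $d-2$ blocks of size one equal to $\theta+\tau$; it is pure of weight $1$ and not almost strictly pure. -/

import Mathlib

open scoped Polynomial PowerSeries TensorProduct

noncomputable section

namespace TMod

section TwistedPolynomials

variable (Fq K : Type*) [Field Fq] [Fintype Fq] [Field K] [Algebra Fq K]

/-- The action of `ℕ` on `K` through the iterates of the `q`-power Frobenius map, `q = #Fq`. -/
abbrev frobAction : MulSemiringAction (Multiplicative ℕ) K :=
  MulSemiringAction.compHom K
    (powersHom (K →+* K) (FiniteField.frobeniusAlgHom Fq K : K →+* K))

/-- The ring `K{τ}` of twisted polynomials, with `τ a = a ^ q τ`, `q = #Fq`. -/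
def TwistedPoly (Fq K : Type*) [Field Fq] [Fintype Fq] [Field K] [Algebra Fq K] : Type _ :=
  SkewPolynomial K

theorem frobAction_smul (n : Multiplicative ℕ) (a : K) :
    letI := frobAction Fq K
    n • a = a ^ (Fintype.card Fq) ^ n.toAdd := by
  change ((FiniteField.frobeniusAlgHom Fq K : K →+* K) ^ n.toAdd) a = _
  generalize n.toAdd = k
  induction k generalizing a with
  | zero => simp
  | succ k ih =>
    rw [pow_succ, RingHom.mul_def, RingHom.comp_apply, ih, pow_succ', pow_mul]
    simp

instance : Ring (TwistedPoly Fq K) :=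
  letI := frobAction Fq K
  inferInstanceAs (Ring (SkewPolynomial K))

/-- `K` acts on `K{τ}` by multiplication on the left. -/
instance : Module K (TwistedPoly Fq K) :=
  inferInstanceAs (Module K (SkewPolynomial K))

instance : IsScalarTower K (TwistedPoly Fq K) (TwistedPoly Fq K) :=
  letI := frobAction Fq K
  inferInstanceAs (IsScalarTower K (SkewPolynomial K) (SkewPolynomial K))

/-- The constants `K ⊆ K{τ}`. -/
def TwistedPoly.C : K →+* TwistedPoly Fq K :=
  letI := frobAction Fq K
  (SkewMonoidAlgebra.singleOneRingHom : K →+* SkewPolynomial K)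

theorem TwistedPoly.C_commutes (c : Fq) (f : TwistedPoly Fq K) :
    TwistedPoly.C Fq K (algebraMap Fq K c) * f = f * TwistedPoly.C Fq K (algebraMap Fq K c) := by
  let := frobAction Fq K
  refine SkewMonoidAlgebra.ext (k := K) (G := Multiplicative ℕ) fun n => ?_
  refine (SkewMonoidAlgebra.coeff_single_one_mul (k := K) (G := Multiplicative ℕ) f _ n).trans
    (Eq.trans ?_
      (SkewMonoidAlgebra.coeff_mul_single_one (k := K) (G := Multiplicative ℕ) f _ n).symm)
  rw [frobAction_smul, ← map_pow, FiniteField.pow_card_pow, mul_comm]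

/-- `Fq` is central in `K{τ}`. -/
instance : Algebra Fq (TwistedPoly Fq K) :=
  ((TwistedPoly.C Fq K).comp (algebraMap Fq K)).toAlgebra' fun c f => TwistedPoly.C_commutes Fq K c f

/-- The variable `τ` of `K{τ}`. -/
def TwistedPoly.tau : TwistedPoly Fq K :=
  (SkewPolynomial.monomial 1 (1 : K) : SkewPolynomial K)

variable {Fq K}

/-- The coefficient of `τ ^ n`. -/
def TwistedPoly.coeff (f : TwistedPoly Fq K) (n : ℕ) : K :=
  SkewPolynomial.coeff (R := K) f n

theorem TwistedPoly.C_mul (a : K) (f : TwistedPoly Fq K) : TwistedPoly.C Fq K a * f = a • f := by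
  let := frobAction Fq K
  refine SkewMonoidAlgebra.ext (k := K) (G := Multiplicative ℕ) fun n => ?_
  exact SkewMonoidAlgebra.coeff_single_one_mul (k := K) (G := Multiplicative ℕ) f a n

theorem TwistedPoly.tau_mul_C (a : K) :
    TwistedPoly.tau Fq K * TwistedPoly.C Fq K a =
      TwistedPoly.C Fq K (a ^ Fintype.card Fq) * TwistedPoly.tau Fq K := by
  let := frobAction Fq K
  have h1 := SkewMonoidAlgebra.single_mul_single (k := K) (G := Multiplicative ℕ)
    (a₁ := Multiplicative.ofAdd 1) (a₂ := 1) (b₁ := 1) (b₂ := a)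
  have h2 := SkewMonoidAlgebra.single_mul_single (k := K) (G := Multiplicative ℕ)
    (a₁ := 1) (a₂ := Multiplicative.ofAdd 1) (b₁ := a ^ Fintype.card Fq) (b₂ := 1)
  rw [frobAction_smul] at h1
  refine h1.trans (Eq.trans ?_ h2.symm)
  simp

theorem TwistedPoly.tau_mul_smul (a : K) (f : TwistedPoly Fq K) :
    TwistedPoly.tau Fq K * (a • f) = (a ^ Fintype.card Fq) • (TwistedPoly.tau Fq K * f) := by
  rw [← TwistedPoly.C_mul, ← TwistedPoly.C_mul, ← mul_assoc, TwistedPoly.tau_mul_C, mul_assoc]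

/-- The matrix `A₀ + A₁ τ + ⋯ + Aᵣ τ ^ r` over `K{τ}`. -/
def tauExpansion {ι : Type*} (r : ℕ) (A : ℕ → Matrix ι ι K) :
    Matrix ι ι (TwistedPoly Fq K) :=
  ∑ i ∈ Finset.range (r + 1),
    (A i).map fun a => TwistedPoly.C Fq K a * TwistedPoly.tau Fq K ^ i

/-- `L` is the leading coefficient of the matrix `P` over `K{τ}`: one has
`P = A₀ + A₁ τ + ⋯ + Aᵣ τ ^ r` with `Aᵣ = L` nonzero. -/
def IsLeadingCoeff {ι : Type*} (P : Matrix ι ι (TwistedPoly Fq K)) (L : Matrix ι ι K) : Prop :=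
  ∃ (r : ℕ) (A : ℕ → Matrix ι ι K), P = tauExpansion r A ∧ A r = L ∧ L ≠ 0

end TwistedPolynomials

section TModules

variable {Fq K : Type*} [Field Fq] [Fintype Fq] [Field K] [Algebra Fq K]

/-- A `t`-module over `K` of dimension `d`, of characteristic `ℓ : Fq[t] → K`, in a coordinate
system: the `Fq`-vector space scheme is `𝔾ₐ ^ d`, its ring of endomorphisms is
`Mat_d(K{τ})`, and the action on the Lie algebra is the constant coefficient in `τ`. -/
structure TModule (ℓ : Fq[X] →ₐ[Fq] K) (d : ℕ) where
  /-- The action of `Fq[t]`. -/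
  φ : Fq[X] →ₐ[Fq] Matrix (Fin d) (Fin d) (TwistedPoly Fq K)
  /-- `dφ_a - ℓ(a)` is nilpotent. -/
  nilpotent : ∀ a : Fq[X],
    IsNilpotent ((φ a).map (fun f => f.coeff 0) - Matrix.scalar (Fin d) (ℓ a))

namespace TModule

variable {ℓ : Fq[X] →ₐ[Fq] K} {d : ℕ} (E : TModule ℓ d)

/-- The matrix `D = φ_t`. -/
def D : Matrix (Fin d) (Fin d) (TwistedPoly Fq K) := E.φ Polynomial.X

/-- Almost strict purity: some power `D ^ s`, `s ≥ 1`, equals `A₀ + A₁ τ + ⋯ + Aᵣ τ ^ r` with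
`Aᵣ` invertible. -/
def IsAlmostStrictlyPure : Prop :=
  ∃ s : ℕ, 1 ≤ s ∧ ∃ (r : ℕ) (A : ℕ → Matrix (Fin d) (Fin d) K),
    E.D ^ s = tauExpansion r A ∧ IsUnit (A r)

/-- The action of `t` on `⨁ K{τ} κᵢ`: it is `K{τ}`-linear and `t κᵢ = ∑ⱼ Dᵢⱼ κⱼ`, so a row
vector `m` goes to `m D`. -/
def tAction : (Fin d → TwistedPoly Fq K) →ₗ[K] (Fin d → TwistedPoly Fq K) where
  toFun m := Matrix.vecMul m E.D
  map_add' m n := Matrix.add_vecMul E.D m n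
  map_smul' a m := Matrix.smul_vecMul a m E.D

/-- The `t`-motive of `E`, the free `K{τ}`-module on `κ₁, …, κ_d`, as a module over `K[t]`. -/
abbrev Motive : Type _ := Module.AEval' E.tAction

/-- The ring endomorphism of `K[t]` which is the `q`-power Frobenius map on coefficients and
fixes `t`. -/
def polyTwist (Fq K : Type*) [Field Fq] [Fintype Fq] [Field K] [Algebra Fq K] : K[X] →+* K[X] :=
  Polynomial.mapRingHom (FiniteField.frobeniusAlgHom Fq K : K →+* K)

/-- Multiplication by `τ` on the left on `⨁ K{τ} κᵢ`. -/
def tauMulAux (Fq K : Type*) [Field Fq] [Fintype Fq] [Field K] [Algebra Fq K] (d : ℕ) :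
    (Fin d → TwistedPoly Fq K) →+ (Fin d → TwistedPoly Fq K) where
  toFun m := TwistedPoly.tau Fq K • m
  map_zero' := smul_zero _
  map_add' := smul_add _

theorem tauMulAux_tAction (m : Fin d → TwistedPoly Fq K) :
    tauMulAux Fq K d (E.tAction m) = E.tAction (tauMulAux Fq K d m) :=
  (Matrix.smul_vecMul (TwistedPoly.tau Fq K) m E.D).symm

theorem tauMulAux_smul (a : K) (m : Fin d → TwistedPoly Fq K) :
    tauMulAux Fq K d (a • m) = (a ^ Fintype.card Fq) • tauMulAux Fq K d m := by
  funext i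
  exact TwistedPoly.tau_mul_smul a (m i)

/-- Multiplication by `τ` on the `t`-motive. -/
def motiveTau : E.Motive →ₛₗ[polyTwist Fq K] E.Motive where
  toFun m := Module.AEval'.of E.tAction (tauMulAux Fq K d ((Module.AEval'.of E.tAction).symm m))
  map_add' m n := by simp
  map_smul' p m := by
    obtain ⟨m, rfl⟩ := (Module.AEval'.of E.tAction).surjective m
    rw [LinearEquiv.symm_apply_apply]
    suffices h : ∀ m, tauMulAux Fq K d ((Polynomial.aeval E.tAction p) m) =
        (Polynomial.aeval E.tAction (polyTwist Fq K p)) (tauMulAux Fq K d m) by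
      have h1 := congrArg (Module.AEval'.of E.tAction) (h m)
      exact h1
    intro m
    induction p using Polynomial.induction_on' generalizing m with
    | add p r hp hr => simp only [map_add, LinearMap.add_apply, hp, hr]
    | monomial n a =>
      have hpow : ∀ (n : ℕ) (m : Fin d → TwistedPoly Fq K),
          tauMulAux Fq K d ((E.tAction ^ n) m) = (E.tAction ^ n) (tauMulAux Fq K d m) := by
        intro n
        induction n with
        | zero => intro m; rfl
        | succ n ih =>
          intro m
          rw [pow_succ, Module.End.mul_apply, Module.End.mul_apply, ih, tauMulAux_tAction]
      simp only [polyTwist, Polynomial.coe_mapRingHom, Polynomial.map_monomial,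
        Polynomial.aeval_monomial, Module.End.mul_apply, Module.algebraMap_end_apply,
        tauMulAux_smul, hpow]
      rfl

/-- `E` is abelian: its `t`-motive is finitely generated over `K[t]`. -/
def IsAbelian : Prop := Module.Finite K[X] E.Motive

/-- The weight `d / rk E`, where `rk E` is the rank of the `t`-motive over `K[t]`. -/
def weight : ℚ := (d : ℚ) / (Module.finrank K[X] E.Motive : ℚ)

end TModule

end TModules

section LaurentSeriesAtInfinity

variable (K : Type*) [Field K]

/-- The field `K((1/t))`: Laurent series in a variable that stands for `1/t`. -/
def LaurentInf (K : Type*) [Field K] : Type _ := LaurentSeries K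

instance : Field (LaurentInf K) := inferInstanceAs (Field (LaurentSeries K))

/-- `K[[1/t]] ⊆ K((1/t))`. -/
instance : Algebra K⟦X⟧ (LaurentInf K) := inferInstanceAs (Algebra K⟦X⟧ (LaurentSeries K))

/-- The constants `K ⊆ K((1/t))`. -/
def LaurentInf.C : K →+* LaurentInf K := (HahnSeries.C : K →+* LaurentSeries K)

/-- The element `t` of `K((1/t))`. -/
def LaurentInf.t : LaurentInf K := (HahnSeries.single (-1 : ℤ) (1 : K) : LaurentSeries K)

/-- `K[t] ⊆ K((1/t))`. -/
instance : Algebra K[X] (LaurentInf K) :=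
  (Polynomial.eval₂RingHom (LaurentInf.C K) (LaurentInf.t K)).toAlgebra

instance : SMulCommClass K[X] K⟦X⟧ (LaurentInf K) where
  smul_comm p f x := by simp only [Algebra.smul_def, mul_left_comm]

end LaurentSeriesAtInfinity

section Purity

variable {Fq K : Type*} [Field Fq] [Fintype Fq] [Field K] [Algebra Fq K]

/-- The `q`-power Frobenius map on the coefficients of Laurent series in `1/t`. -/
def laurentTwistFun (Fq : Type*) {K : Type*} [Field Fq] [Fintype Fq] [Field K] [Algebra Fq K]
    (f : LaurentInf K) : LaurentInf K :=
  (HahnSeries.map (f : LaurentSeries K) (FiniteField.frobeniusAlgHom Fq K : K →+* K) :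
    LaurentSeries K)

/-- The `q`-power Frobenius map on coefficients, as a ring endomorphism of `K((1/t))`. -/
def laurentTwist (Fq K : Type*) [Field Fq] [Fintype Fq] [Field K] [Algebra Fq K] :
    LaurentInf K →+* LaurentInf K where
  toFun := laurentTwistFun Fq
  map_zero' := HahnSeries.ext (funext fun _ =>
    map_zero (FiniteField.frobeniusAlgHom Fq K : K →+* K))
  map_one' := HahnSeries.map_one
    (RingHom.toMonoidWithZeroHom (FiniteField.frobeniusAlgHom Fq K : K →+* K))
  map_add' _ _ := HahnSeries.ext (funext fun _ =>
    map_add (FiniteField.frobeniusAlgHom Fq K : K →+* K) _ _)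
  map_mul' _ _ := HahnSeries.map_mul
    ((FiniteField.frobeniusAlgHom Fq K : K →+* K) : K →ₙ+* K)

theorem laurentTwist_algebraMap (p : K[X]) :
    laurentTwist Fq K (algebraMap K[X] (LaurentInf K) p) =
      algebraMap K[X] (LaurentInf K) (TModule.polyTwist Fq K p) := by
  refine RingHom.congr_fun (f := (laurentTwist Fq K).comp (algebraMap K[X] (LaurentInf K)))
    (g := (algebraMap K[X] (LaurentInf K)).comp (TModule.polyTwist Fq K)) ?_ p
  refine Polynomial.ringHom_ext (fun a => ?_) ?_
  · have h : ∀ b : K, algebraMap K[X] (LaurentInf K) (Polynomial.C b) =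
        LaurentInf.C K b := fun b => Polynomial.eval₂_C (LaurentInf.C K) (LaurentInf.t K)
    simp only [RingHom.comp_apply, TModule.polyTwist, Polynomial.coe_mapRingHom,
      Polynomial.map_C, h]
    exact HahnSeries.map_C a (FiniteField.frobeniusAlgHom Fq K : K →+* K)
  · have h : algebraMap K[X] (LaurentInf K) Polynomial.X = LaurentInf.t K :=
      Polynomial.eval₂_X (LaurentInf.C K) (LaurentInf.t K)
    simp only [RingHom.comp_apply, TModule.polyTwist, Polynomial.coe_mapRingHom,
      Polynomial.map_X, h]
    refine HahnSeries.ext (funext fun n => ?_)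
    change (FiniteField.frobeniusAlgHom Fq K : K →+* K)
      ((HahnSeries.single (-1 : ℤ) (1 : K)).coeff n) = (HahnSeries.single (-1 : ℤ) (1 : K)).coeff n
    by_cases hn : n = -1
    · subst hn
      simp
    · simp [HahnSeries.coeff_single_of_ne hn]

namespace TModule

variable {ℓ : Fq[X] →ₐ[Fq] K} {d : ℕ} (E : TModule ℓ d)

/-- The space `K((1/t)) ⊗_{K[t]} M(E)`. -/
abbrev MotiveInf : Type _ := LaurentInf K ⊗[K[X]] E.Motive

/-- The semilinear action of `τ` on `K((1/t)) ⊗_{K[t]} M(E)`, with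
`τ (f ⊗ m) = f⁽¹⁾ ⊗ τ m`, where `f⁽¹⁾` is `f` with coefficients raised to the power `q`. -/
def tauInf : E.MotiveInf →ₛₗ[polyTwist Fq K] E.MotiveInf :=
  TensorProduct.lift <|
    LinearMap.mk₂'ₛₗ (polyTwist Fq K) (polyTwist Fq K)
      (fun (f : LaurentInf K) (m : E.Motive) => laurentTwist Fq K f ⊗ₜ[K[X]] E.motiveTau m)
      (fun f g m => by rw [map_add, TensorProduct.add_tmul])
      (fun p f m => by
        rw [Algebra.smul_def, map_mul, laurentTwist_algebraMap, ← Algebra.smul_def,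
          TensorProduct.smul_tmul'])
      (fun f m n => by rw [map_add, TensorProduct.tmul_add])
      (fun p f m => by rw [LinearMap.map_smulₛₗ, TensorProduct.tmul_smul])

theorem tauInf_tmul (f : LaurentInf K) (m : E.Motive) :
    E.tauInf (f ⊗ₜ m) = laurentTwist Fq K f ⊗ₜ E.motiveTau m := rfl

/-- `E` is pure: it is abelian and there are a `K[[1/t]]`-lattice `Λ` in
`K((1/t)) ⊗_{K[t]} M(E)` and positive integers `u`, `v` with `t ^ u Λ = τ ^ v Λ`. -/
def IsPure : Prop :=
  E.IsAbelian ∧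
    ∃ Λ : Submodule K⟦X⟧ E.MotiveInf, Λ.IsLattice (LaurentInf K) ∧
      ∃ u v : ℕ, 0 < u ∧ 0 < v ∧
        (fun x : E.MotiveInf => LaurentInf.t K ^ u • x) '' (Λ : Set E.MotiveInf) =
          (fun x : E.MotiveInf => E.tauInf^[v] x) '' (Λ : Set E.MotiveInf)

end TModule

end Purity

section Examples

variable (Fq : Type*) {K : Type*} [Field Fq] [Fintype Fq] [Field K] [Algebra Fq K]

/-- The matrix `θ I + I τ + (0 0; θ 0) τ ^ 2`. -/
def exampleTwo (θ : K) : Matrix (Fin 2) (Fin 2) (TwistedPoly Fq K) :=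
  Matrix.scalar (Fin 2) (TwistedPoly.C Fq K θ) + Matrix.scalar (Fin 2) (TwistedPoly.tau Fq K) +
    !![0, 0; TwistedPoly.C Fq K θ * TwistedPoly.tau Fq K ^ 2, 0]

/-- The block diagonal matrix with one block `exampleTwo` followed by `m` blocks `θ + τ` of
size one. -/
def exampleBlock (θ : K) (m : ℕ) :
    Matrix (Fin (2 + m)) (Fin (2 + m)) (TwistedPoly Fq K) :=
  Matrix.reindex finSumFinEquiv finSumFinEquiv
    (Matrix.fromBlocks (exampleTwo Fq θ) 0 0
      (Matrix.diagonal fun _ : Fin m => TwistedPoly.C Fq K θ + TwistedPoly.tau Fq K))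

end Examples

end TMod

end

/-! For `i ≠ j` and `α` in `K`, consider `D = (θ + τ) I + α τ² E_ij`; the examples in (b) are the
case `α = θ`, while in (a) `α` is any element transcendental over `Fq`.

Not almost strictly pure: since `E_ij² = 0`, the power `D ^ n` is `(θ + τ) ^ n I` plus a single
entry at `(i, j)`. That entry has degree at most `n + 1`, and its coefficient of `τ ^ (n + 1)` is `α
+ α ^ q + ⋯ + α ^ (q ^ (n - 1))` (`coeff_shearEntry`). This is nonzero for transcendental `α` and `n
≥ 1`, so the leading coefficient of `D ^ n` is a nonzero multiple of `E_ij`, which is singular.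

Pure: in the motive, `τ κ_k = (t - θ) κ_k` for `k ≠ i`, while `τ κ_i = (t - θ) κ_i - α (t - θ ^ q)(t
- θ) κ_j`. Hence the `κ_k` form a `K[t]`-basis and the weight is `1`. The quadratic term is absorbed
by replacing `κ_j` with `t κ_j`: in the new basis `τ` is `t` times a matrix invertible over
`K[[1/t]]`, so the lattice `Λ` spanned by that basis satisfies `t Λ = τ Λ` (`shearModule_isPure`).
-/

noncomputable section

namespace TMod

/-! ### Coefficients of twisted polynomials and of the powers of `θ + τ`. -/

section TwistedPolynomials

variable {Fq K : Type*} [Field Fq] [Fintype Fq] [Field K] [Algebra Fq K]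

namespace TwistedPoly

@[ext]
theorem ext {f g : TwistedPoly Fq K} (h : ∀ n, f.coeff n = g.coeff n) : f = g :=
  SkewPolynomial.ext (R := K) h

@[simp]
theorem coeff_zero (n : ℕ) : (0 : TwistedPoly Fq K).coeff n = 0 := rfl

@[simp]
theorem coeff_add (f g : TwistedPoly Fq K) (n : ℕ) :
    (f + g).coeff n = f.coeff n + g.coeff n :=
  SkewPolynomial.coeff_add (R := K) f g n

@[simp]
theorem coeff_smul (a : K) (f : TwistedPoly Fq K) (n : ℕ) :
    (a • f).coeff n = a * f.coeff n := rfl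

@[simp]
theorem coeff_C_mul (a : K) (f : TwistedPoly Fq K) (n : ℕ) :
    (C Fq K a * f).coeff n = a * f.coeff n := by
  rw [C_mul, coeff_smul]

theorem coeff_one (n : ℕ) : (1 : TwistedPoly Fq K).coeff n = if n = 0 then 1 else 0 := by
  let := frobAction Fq K
  exact (SkewPolynomial.coeff_one (R := K) n).trans (by simp [eq_comm])

@[simp]
theorem coeff_tau_mul_zero (f : TwistedPoly Fq K) : (tau Fq K * f).coeff 0 = 0 := by
  let := frobAction Fq K
  refine SkewMonoidAlgebra.coeff_single_mul_of_not_exists_mul (k := K) (G := Multiplicative ℕ)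
    1 f ?_
  rintro ⟨d, hd⟩
  have := congrArg Multiplicative.toAdd hd
  rw [toAdd_mul, toAdd_ofAdd, toAdd_ofAdd] at this
  omega

@[simp]
theorem coeff_tau_mul_succ (f : TwistedPoly Fq K) (n : ℕ) :
    (tau Fq K * f).coeff (n + 1) = f.coeff n ^ Fintype.card Fq := by
  let := frobAction Fq K
  have h := SkewMonoidAlgebra.coeff_single_mul_aux (k := K) (G := Multiplicative ℕ) f (r := 1)
    (x := Multiplicative.ofAdd 1) (y := Multiplicative.ofAdd (n + 1))
    (z := Multiplicative.ofAdd n) (fun a => by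
      rw [add_comm n 1, ofAdd_add, mul_right_inj])
  refine h.trans ?_
  rw [one_mul, frobAction_smul]
  simp [coeff, SkewPolynomial.coeff]

theorem coeff_tau_pow (i n : ℕ) : (tau Fq K ^ i).coeff n = if n = i then 1 else 0 := by
  induction i generalizing n with
  | zero => rw [pow_zero, coeff_one]
  | succ i ih =>
    rw [pow_succ']
    cases n with
    | zero => simp
    | succ n =>
      rw [coeff_tau_mul_succ, ih]
      split_ifs <;> simp_all [Fintype.card_ne_zero]

/-- The coefficient of `τ ^ n`, as a `K`-linear form. -/
def coeffHom (n : ℕ) : TwistedPoly Fq K →ₗ[K] K where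
  toFun f := f.coeff n
  map_add' f g := coeff_add f g n
  map_smul' a f := coeff_smul a f n

@[simp]
theorem coeffHom_apply (n : ℕ) (f : TwistedPoly Fq K) : coeffHom n f = f.coeff n := rfl

@[elab_as_elim]
theorem induction_on {motive : TwistedPoly Fq K → Prop} (f : TwistedPoly Fq K)
    (zero : motive 0) (add : ∀ f g, motive f → motive g → motive (f + g))
    (term : ∀ (n : ℕ) (a : K), motive (a • tau Fq K ^ n)) : motive f := by
  let := frobAction Fq K
  refine SkewMonoidAlgebra.induction_on (k := K) (G := Multiplicative ℕ)
    (p := motive) f zero (fun g a => ?_) (fun f g hf hg => add f g hf hg)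
  have : (a • tau Fq K ^ g.toAdd : TwistedPoly Fq K) = SkewMonoidAlgebra.single g a := by
    ext n
    rw [coeff_smul, coeff_tau_pow]
    refine Eq.trans ?_ (SkewPolynomial.coeff_monomial (R := K) (n := g.toAdd) (m := n)).symm
    simp [eq_comm]
  exact this ▸ term g.toAdd a

theorem coeff_mul_zero (f g : TwistedPoly Fq K) : (f * g).coeff 0 = f.coeff 0 * g.coeff 0 := by
  induction f using induction_on with
  | zero => simp
  | add f₁ f₂ h₁ h₂ => simp [add_mul, h₁, h₂]
  | term n a =>
    rw [smul_mul_assoc, coeff_smul, coeff_smul]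
    cases n with
    | zero => simp [coeff_one]
    | succ n => simp [pow_succ', mul_assoc]

variable (Fq K) in
/-- The constant coefficient, as a homomorphism of `Fq`-algebras. -/
def constCoeff : TwistedPoly Fq K →ₐ[Fq] K where
  toFun f := f.coeff 0
  map_one' := by simp [coeff_one]
  map_mul' := coeff_mul_zero
  map_zero' := rfl
  map_add' f g := coeff_add f g 0
  commutes' c := by
    change (C Fq K (algebraMap Fq K c)).coeff 0 = _
    rw [← mul_one (C Fq K _), coeff_C_mul, coeff_one]
    simp

/-- The element `θ + τ`. -/
def carlitz (Fq : Type*) {K : Type*} [Field Fq] [Fintype Fq] [Field K] [Algebra Fq K] (θ : K) :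
    TwistedPoly Fq K := C Fq K θ + tau Fq K

theorem coeff_carlitz_mul_succ (θ : K) (f : TwistedPoly Fq K) (n : ℕ) :
    (carlitz Fq θ * f).coeff (n + 1) = θ * f.coeff (n + 1) + f.coeff n ^ Fintype.card Fq := by
  simp [carlitz, add_mul]

theorem coeff_carlitz_pow_of_lt (θ : K) {n k : ℕ} (h : n < k) :
    (carlitz Fq θ ^ n).coeff k = 0 := by
  induction n generalizing k with
  | zero => simp [coeff_one, h.ne']
  | succ n ih =>
    obtain ⟨k, rfl⟩ : ∃ m, k = m + 1 := ⟨k - 1, by omega⟩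
    rw [pow_succ', coeff_carlitz_mul_succ, ih (by omega), ih (by omega)]
    simp [Fintype.card_ne_zero]

theorem coeff_carlitz_pow_self (θ : K) (n : ℕ) : (carlitz Fq θ ^ n).coeff n = 1 := by
  induction n with
  | zero => simp [coeff_one]
  | succ n ih =>
    rw [pow_succ', coeff_carlitz_mul_succ, ih, coeff_carlitz_pow_of_lt θ (by omega)]
    simp

/-- The powers of `θ + τ` are linearly independent over `K`. -/
theorem eq_zero_of_sum_smul_carlitz_pow_eq_zero (θ : K) {p : K[X]}
    (h : (p.sum fun n a => a • carlitz Fq θ ^ n) = 0) : p = 0 := by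
  by_contra hp
  -- `(θ + τ) ^ n` is monic of degree `n`, so this coefficient of the sum is the leading coefficient
  -- of `p`.
  have h1 := congrArg (coeffHom p.natDegree) h
  rw [Polynomial.sum_over_range _ (by simp), map_sum, Finset.sum_range_succ,
    Finset.sum_eq_zero (fun i hi => ?_)] at h1
  · simp [coeff_carlitz_pow_self, hp] at h1
  · simp [coeff_carlitz_pow_of_lt θ (Finset.mem_range.1 hi)]

/-- The lower left entry of `!![θ + τ, 0; ατ², θ + τ] ^ n`. -/
def shearEntry (θ α : K) : ℕ → TwistedPoly Fq K
  | 0 => 0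
  | n + 1 => carlitz Fq θ * shearEntry θ α n + C Fq K α * tau Fq K ^ 2 * carlitz Fq θ ^ n

theorem coeff_C_mul_tau_sq_mul (α : K) (f : TwistedPoly Fq K) (n : ℕ) :
    (C Fq K α * tau Fq K ^ 2 * f).coeff (n + 2) =
      α * (f.coeff n ^ Fintype.card Fq) ^ Fintype.card Fq := by
  rw [mul_assoc, coeff_C_mul, pow_two, mul_assoc, coeff_tau_mul_succ, coeff_tau_mul_succ]

theorem coeff_shearEntry_of_lt (θ α : K) {n k : ℕ} (h : n + 1 < k) :
    (shearEntry θ α n : TwistedPoly Fq K).coeff k = 0 := by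
  induction n generalizing k with
  | zero => rfl
  | succ n ih =>
    obtain ⟨k, rfl⟩ : ∃ m, k = m + 2 := ⟨k - 2, by omega⟩
    rw [shearEntry, coeff_add, coeff_carlitz_mul_succ, ih (by omega), ih (by omega),
      coeff_C_mul_tau_sq_mul, coeff_carlitz_pow_of_lt θ (by omega)]
    simp [Fintype.card_ne_zero]

variable (Fq) in
/-- The polynomial `X + X ^ q + ⋯ + X ^ (q ^ (n - 1))`. -/
def tracePoly : ℕ → Fq[X]
  | 0 => 0
  | n + 1 => tracePoly n ^ Fintype.card Fq + Polynomial.X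

/-- The derivative is `1`, because `q = 0` in `Fq`. -/
theorem tracePoly_ne_zero {n : ℕ} (hn : n ≠ 0) : tracePoly Fq n ≠ 0 := by
  obtain ⟨n, rfl⟩ := Nat.exists_eq_succ_of_ne_zero hn
  intro h
  have := congrArg Polynomial.derivative h
  rw [tracePoly, Polynomial.derivative_add, Polynomial.derivative_pow] at this
  simp at this

/-- Left multiplication by `θ + τ` raises the top coefficient to the power `q`, and `α τ² (θ + τ) ^
n` adds `α` to it: this is the recursion of `tracePoly`. -/
theorem coeff_shearEntry (θ α : K) (n : ℕ) :
    (shearEntry θ α n : TwistedPoly Fq K).coeff (n + 1) = (tracePoly Fq n).aeval α := by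
  induction n with
  | zero => simp [shearEntry, tracePoly]
  | succ n ih =>
    rw [shearEntry, coeff_add, coeff_carlitz_mul_succ, ih, coeff_shearEntry_of_lt θ α (by omega),
      coeff_C_mul_tau_sq_mul, coeff_carlitz_pow_self]
    simp [tracePoly]

end TwistedPoly

end TwistedPolynomials

open TwistedPoly

/-! ### Powers of the matrix `(θ + τ) I + α τ² E_ij` and their leading coefficients. -/

section Shear

variable {Fq K : Type*} [Field Fq] [Fintype Fq] [Field K] [Algebra Fq K]

variable {ι : Type*} [Fintype ι] [DecidableEq ι]

/-- The matrix `(θ + τ) I + α τ ^ 2 E_{ij}`. -/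
def shearMatrix (Fq : Type*) {K : Type*} [Field Fq] [Fintype Fq] [Field K] [Algebra Fq K]
    (θ α : K) (i j : ι) : Matrix ι ι (TwistedPoly Fq K) :=
  Matrix.scalar ι (carlitz Fq θ) + Matrix.single i j (C Fq K α * tau Fq K ^ 2)

/-- As `i ≠ j`, `E_ij` squares to zero even with coefficients in a noncommutative ring, so only
terms with at most one off-diagonal factor survive. -/
theorem shearMatrix_pow (θ α : K) {i j : ι} (hij : i ≠ j) (n : ℕ) :
    shearMatrix Fq θ α i j ^ n =
      Matrix.scalar ι (carlitz Fq θ ^ n) + Matrix.single i j (shearEntry θ α n) := by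
  induction n with
  | zero => simp [shearEntry]
  | succ n ih =>
    rw [pow_succ', ih, shearMatrix, add_mul, mul_add, mul_add, shearEntry]
    rw [Matrix.single_mul_single_of_ne _ _ _ _ hij.symm, add_zero, ← map_mul, ← pow_succ',
      Matrix.single_add, add_assoc]
    congr 2
    · ext1 k m
      simp [Matrix.diagonal_mul, Matrix.single_apply]
    · ext1 k m
      simp [Matrix.mul_diagonal, Matrix.single_apply]

theorem shearMatrix_pow_apply_self (θ α : K) {i j : ι} (hij : i ≠ j) (n : ℕ) :
    (shearMatrix Fq θ α i j ^ n) i j = shearEntry θ α n := by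
  rw [shearMatrix_pow θ α hij]
  simp [hij]

theorem shearMatrix_pow_apply_of_ne (θ α : K) {i j : ι} (hij : i ≠ j) (n : ℕ) {k m : ι}
    (h : ¬(i = k ∧ j = m)) :
    (shearMatrix Fq θ α i j ^ n) k m = if k = m then carlitz Fq θ ^ n else 0 := by
  rw [shearMatrix_pow θ α hij, Matrix.add_apply, Matrix.single_apply, if_neg h, add_zero,
    Matrix.scalar_apply, Matrix.diagonal_apply]

theorem coeff_tauExpansion {ι : Type*} (r : ℕ) (A : ℕ → Matrix ι ι K) (k m : ι) (n : ℕ) :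
    ((tauExpansion r A : Matrix ι ι (TwistedPoly Fq K)) k m).coeff n =
      if n ≤ r then A n k m else 0 := by
  rw [tauExpansion, Matrix.sum_apply, ← coeffHom_apply, map_sum]
  simp [coeff_tau_pow, Finset.sum_ite_eq]

/-- The expansion may be padded with zero matrices, so `r` only bounds the degree. The entry `(i,
j)`, of exact degree `n + 1`, forces `r ≥ n + 1`, and row `j`, of degree `n`, then vanishes in `A
r`. -/
theorem not_isUnit_of_shearMatrix_pow_eq_tauExpansion {θ α : K} (hα : Transcendental Fq α)
    {i j : ι} (hij : i ≠ j) {n : ℕ} (hn : 1 ≤ n) {r : ℕ} {A : ℕ → Matrix ι ι K}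
    (h : shearMatrix Fq θ α i j ^ n = tauExpansion r A) : ¬ IsUnit (A r) := by
  intro hu
  have hc (k m : ι) (e : ℕ) := congrArg (fun P => (P k m).coeff e) h
  simp only [coeff_tauExpansion] at hc
  have hne : (tracePoly Fq n).aeval α ≠ 0 := fun h0 =>
    tracePoly_ne_zero (by omega) ((transcendental_iff.1 hα) _ h0)
  have h1 := hc i j (n + 1)
  rw [shearMatrix_pow_apply_self θ α hij, coeff_shearEntry] at h1
  have hr : n + 1 ≤ r := by
    by_contra hr
    rw [if_neg hr] at h1
    exact hne h1
  have hrow : A r j = 0 := by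
    funext m
    have h2 := hc j m r
    rw [shearMatrix_pow_apply_of_ne θ α hij n (fun h => hij h.1), if_pos le_rfl] at h2
    rw [← h2]
    split_ifs
    · exact coeff_carlitz_pow_of_lt θ (by omega)
    · rfl
  exact ((Matrix.isUnit_iff_isUnit_det _).1 hu).ne_zero
    (Matrix.det_eq_zero_of_row_eq_zero j (congrFun hrow))

theorem constCoeff_mapMatrix_shearMatrix (θ α : K) (i j : ι) :
    (constCoeff Fq K).mapMatrix (shearMatrix Fq θ α i j) = Matrix.scalar ι θ := by
  have h1 : constCoeff Fq K (carlitz Fq θ) = θ := by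
    change (carlitz Fq θ).coeff 0 = θ
    have h := coeff_C_mul (Fq := Fq) θ 1 0
    have h' := coeff_tau_mul_zero (1 : TwistedPoly Fq K)
    rw [mul_one] at h h'
    rw [carlitz, coeff_add, h, h', coeff_one]
    simp
  have h2 : constCoeff Fq K (C Fq K α * tau Fq K ^ 2) = 0 := by
    change (C Fq K α * tau Fq K ^ 2).coeff 0 = 0
    simp [coeff_tau_pow]
  ext k m
  simp [shearMatrix, Matrix.diagonal_apply, Matrix.single_apply, apply_ite (constCoeff Fq K),
    h1, h2]

end Shear

/-! ### The `t`-module defined by the shear matrix. -/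

section ShearModule

variable {Fq K : Type*} [Field Fq] [Fintype Fq] [Field K] [Algebra Fq K]

/-- The `t`-module with `φ_t = (θ + τ) I + α τ ^ 2 E_{ij}`. -/
def shearModule (l : Fq[X] →ₐ[Fq] K) {d : ℕ} (α : K) (i j : Fin d) : TModule l d where
  φ := Polynomial.aeval (shearMatrix Fq (l Polynomial.X) α i j)
  nilpotent a := by
    -- Both sides are homomorphisms of `Fq`-algebras on `Fq[t]`, so agreement at `t` suffices; thus
    -- `dφ_a` equals `ℓ(a) I` exactly, and the nilpotent part is zero.
    have h : ((constCoeff Fq K).mapMatrix.comp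
        (Polynomial.aeval (shearMatrix Fq (l Polynomial.X) α i j))) =
        (Matrix.scalarAlgHom (Fin d) Fq).comp l := by
      refine Polynomial.algHom_ext ?_
      rw [AlgHom.comp_apply, Polynomial.aeval_X, constCoeff_mapMatrix_shearMatrix]
      rfl
    have h1 := DFunLike.congr_fun h a
    refine (sub_eq_zero.2 ?_ : _ = (0 : Matrix (Fin d) (Fin d) K)) ▸ IsNilpotent.zero
    exact h1

variable (l : Fq[X] →ₐ[Fq] K) {d : ℕ} (α : K) (i j : Fin d)

theorem shearModule_D : (shearModule l α i j).D = shearMatrix Fq (l Polynomial.X) α i j :=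
  Polynomial.aeval_X _

variable {α i j}

theorem shearModule_not_isAlmostStrictlyPure (hα : Transcendental Fq α) (hij : i ≠ j) :
    ¬ (shearModule l α i j).IsAlmostStrictlyPure := by
  rintro ⟨s, hs, r, A, h, hu⟩
  rw [shearModule_D] at h
  exact not_isUnit_of_shearMatrix_pow_eq_tauExpansion hα hij hs h hu

end ShearModule

section Examples

variable {Fq K : Type*} [Field Fq] [Fintype Fq] [Field K] [Algebra Fq K]

theorem exampleTwo_eq_shearMatrix (θ : K) :
    exampleTwo Fq θ = shearMatrix Fq θ θ 1 0 := by
  ext1 k m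
  fin_cases k <;> fin_cases m <;> simp [exampleTwo, shearMatrix, carlitz]

theorem exampleBlock_eq_shearMatrix (θ : K) (m : ℕ) :
    exampleBlock Fq θ m =
      shearMatrix Fq θ θ (Fin.castAdd m (1 : Fin 2)) (Fin.castAdd m (0 : Fin 2)) := by
  have h : Matrix.fromBlocks (exampleTwo Fq θ) 0 0
      (Matrix.diagonal fun _ : Fin m => C Fq K θ + tau Fq K) =
      shearMatrix Fq θ θ (Sum.inl (1 : Fin 2)) (Sum.inl (0 : Fin 2)) := by
    rw [exampleTwo_eq_shearMatrix]
    ext1 (a | a) (b | b) <;>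
      simp [shearMatrix, Matrix.diagonal_apply, Matrix.single_apply, carlitz]
  rw [exampleBlock, h]
  ext1 a b
  obtain ⟨a, rfl⟩ := finSumFinEquiv.surjective a
  obtain ⟨b, rfl⟩ := finSumFinEquiv.surjective b
  have h0 : Fin.castAdd m (0 : Fin 2) = finSumFinEquiv (Sum.inl 0) := rfl
  have h1 : Fin.castAdd m (1 : Fin 2) = finSumFinEquiv (Sum.inl 1) := rfl
  rw [h0, h1]
  simp [shearMatrix, Matrix.diagonal_apply, Matrix.single_apply, -finSumFinEquiv_apply_left,
    -finSumFinEquiv_apply_right]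

end Examples

/-! ### Generators of a `t`-motive over `K[t]`. -/

namespace TModule

variable {Fq K : Type*} [Field Fq] [Fintype Fq] [Field K] [Algebra Fq K]
variable {l : Fq[X] →ₐ[Fq] K} {d : ℕ} (E : TModule l d)

/-- The generator `κ_k` of the `t`-motive. -/
def kappa (k : Fin d) : E.Motive := Module.AEval'.of E.tAction (Pi.single k 1)

theorem tAction_pow (n : ℕ) (m : Fin d → TwistedPoly Fq K) :
    (E.tAction ^ n) m = Matrix.vecMul m (E.D ^ n) := by
  induction n generalizing m with
  | zero => simp
  | succ n ih =>
    rw [pow_succ, Module.End.mul_apply, ih, pow_succ', ← Matrix.vecMul_vecMul]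
    rfl

theorem coe_smul_kappa (p : K[X]) (k m : Fin d) :
    (Module.AEval'.of E.tAction).symm (p • E.kappa k) m =
      p.sum fun n a => a • (E.D ^ n) k m := by
  change (Polynomial.aeval E.tAction p) (Pi.single k 1) m = _
  rw [Polynomial.aeval_eq_sum_range, Polynomial.sum_over_range _ (by simp)]
  simp [LinearMap.sum_apply, Finset.sum_apply, tAction_pow]

theorem X_smul_kappa (k : Fin d) :
    (Polynomial.X : K[X]) • E.kappa k = Module.AEval'.of E.tAction (E.D k) := by
  rw [kappa, Module.AEval'.X_smul_of]
  congr 1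
  exact Matrix.single_one_vecMul k E.D

theorem motiveTau_of (m : Fin d → TwistedPoly Fq K) :
    E.motiveTau (Module.AEval'.of E.tAction m) =
      Module.AEval'.of E.tAction (tau Fq K • m) := rfl

/-- If the `K[t]`-span of the `κ_k` is stable under `τ`, it is the whole `t`-motive. -/
theorem span_kappa_eq_top
    (h : ∀ k, E.motiveTau (E.kappa k) ∈ Submodule.span K[X] (Set.range E.kappa)) :
    Submodule.span K[X] (Set.range E.kappa) = ⊤ := by
  set N := Submodule.span K[X] (Set.range E.kappa)
  have hτ : ∀ x ∈ N, E.motiveTau x ∈ N := by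
    have : N ≤ N.comap E.motiveTau := by
      refine Submodule.span_le.2 ?_
      rintro _ ⟨k, rfl⟩
      exact h k
    exact this
  -- The elements `τ ^ n κ_k` span the motive over `K`, and `K` acts through the constants of
  -- `K[t]`.
  have hpow : ∀ (k : Fin d) (n : ℕ),
      Module.AEval'.of E.tAction (Pi.single k (tau Fq K ^ n)) ∈ N := by
    intro k n
    induction n with
    | zero => exact Submodule.subset_span ⟨k, rfl⟩
    | succ n ih =>
      have := hτ _ ih
      rwa [motiveTau_of, ← Pi.single_smul, smul_eq_mul, ← pow_succ'] at this
  have hsingle : ∀ (k : Fin d) (f : TwistedPoly Fq K),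
      Module.AEval'.of E.tAction (Pi.single k f) ∈ N := by
    intro k f
    induction f using TwistedPoly.induction_on with
    | zero => simp
    | add f g hf hg => rw [Pi.single_add, map_add]; exact N.add_mem hf hg
    | term n a =>
      rw [Pi.single_smul, map_smul, ← Module.AEval.C_smul]
      exact N.smul_mem _ (hpow k n)
  refine eq_top_iff.2 fun x _ => ?_
  obtain ⟨m, rfl⟩ := (Module.AEval'.of E.tAction).surjective x
  rw [← Finset.univ_sum_single m, map_sum]
  exact N.sum_mem fun k _ => hsingle k (m k)

end TModule

/-! ### The motive of the shear module is free of rank `d` over `K[t]`. -/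

section Motive

variable {Fq K : Type*} [Field Fq] [Fintype Fq] [Field K] [Algebra Fq K]
variable (l : Fq[X] →ₐ[Fq] K) {d : ℕ} (α : K) {i j : Fin d}

open TModule

/-- Row `k` of `D` is diagonal, so `t κ_k = (θ + τ) κ_k`. -/
theorem shearModule_motiveTau_kappa_of_ne {k : Fin d} (hk : k ≠ i) :
    (shearModule l α i j).motiveTau ((shearModule l α i j).kappa k) =
      (Polynomial.X - Polynomial.C (l Polynomial.X)) • (shearModule l α i j).kappa k := by
  rw [sub_smul, X_smul_kappa, Module.AEval.C_smul, kappa, motiveTau_of, ← map_smul, ← map_sub]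
  congr 1
  funext m
  simp only [shearModule_D, shearMatrix, Pi.smul_apply, Pi.sub_apply, Matrix.add_apply,
    Matrix.scalar_apply, Matrix.diagonal_apply, Matrix.single_apply, hk.symm, false_and, if_false,
    add_zero, carlitz, Pi.single_apply, eq_comm (a := m)]
  split_ifs <;> simp [← C_mul]

/-- Row `i` of `D` gives `t κ_i = (θ + τ) κ_i + α τ² κ_j`. The term `τ² κ_j` is turned into a
multiple of `κ_j` by the previous lemma used twice; the second `τ` twists `θ` to `θ ^ q`. -/
theorem shearModule_motiveTau_kappa_self (hij : i ≠ j) :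
    (shearModule l α i j).motiveTau ((shearModule l α i j).kappa i) =
      (Polynomial.X - Polynomial.C (l Polynomial.X)) • (shearModule l α i j).kappa i -
      (Polynomial.C α * (Polynomial.X - Polynomial.C (l Polynomial.X ^ Fintype.card Fq)) *
        (Polynomial.X - Polynomial.C (l Polynomial.X))) • (shearModule l α i j).kappa j := by
  have h2 : (shearModule l α i j).motiveTau
      ((shearModule l α i j).motiveTau ((shearModule l α i j).kappa j)) =
      ((Polynomial.X - Polynomial.C (l Polynomial.X ^ Fintype.card Fq)) *
        (Polynomial.X - Polynomial.C (l Polynomial.X))) • (shearModule l α i j).kappa j := by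
    rw [shearModule_motiveTau_kappa_of_ne l α hij.symm, LinearMap.map_smulₛₗ,
      shearModule_motiveTau_kappa_of_ne l α hij.symm, smul_smul]
    simp [polyTwist]
  rw [mul_assoc, mul_smul, ← h2, sub_smul, X_smul_kappa, Module.AEval.C_smul,
    Module.AEval.C_smul, kappa, kappa, motiveTau_of, motiveTau_of, motiveTau_of, ← map_smul,
    ← map_smul, ← map_sub, ← map_sub]
  congr 1
  funext m
  simp only [shearModule_D, shearMatrix, Pi.smul_apply, Pi.sub_apply, Matrix.add_apply,
    Matrix.scalar_apply, Matrix.diagonal_apply, Matrix.single_apply, true_and,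
    carlitz, Pi.single_apply, eq_comm (a := m), smul_eq_mul, ← C_mul]
  split_ifs
  all_goals
    simp only [mul_one, mul_zero, add_zero, sub_zero, sub_self, pow_two]
    try abel

/-- A coordinate `m ≠ j` of the relation involves `g m` alone, which then vanishes by independence
of the powers of `θ + τ`. In particular `g i = 0`, so coordinate `j` involves only `g j`. -/
theorem shearModule_linearIndependent_kappa (hij : i ≠ j) :
    LinearIndependent K[X] (shearModule l α i j).kappa := by
  rw [Fintype.linearIndependent_iff]
  intro g hg
  have hcoord (m : Fin d) : ∑ k, ((g k).sum fun n a =>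
      a • (shearMatrix Fq (l Polynomial.X) α i j ^ n) k m) = 0 := by
    have := congrArg (fun x => (Module.AEval'.of (shearModule l α i j).tAction).symm x m) hg
    simpa only [map_sum, Finset.sum_apply, coe_smul_kappa, shearModule_D, map_zero,
      Pi.zero_apply] using this
  have hterm (k m : Fin d) (h : g k = 0 ∨ ¬(i = k ∧ j = m)) : ((g k).sum fun n a =>
      a • (shearMatrix Fq (l Polynomial.X) α i j ^ n) k m) =
      if k = m then (g k).sum fun n a => a • carlitz Fq (l Polynomial.X) ^ n else 0 := by
    rcases h with h | h
    · simp [h]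
    · simp only [shearMatrix_pow_apply_of_ne _ α hij _ h]
      split_ifs
      · rfl
      · simp [Polynomial.sum]
  have hzero (m : Fin d) (h : g i = 0 ∨ j ≠ m) : g m = 0 := by
    have h1 := hcoord m
    rw [Finset.sum_congr rfl fun k _ => hterm k m ?_] at h1
    · rw [Finset.sum_ite_eq' Finset.univ m, if_pos (Finset.mem_univ m)] at h1
      exact eq_zero_of_sum_smul_carlitz_pow_eq_zero _ h1
    · by_cases hk : i = k
      · subst hk
        exact h.imp_right fun h h' => h h'.2
      · exact Or.inr fun h' => hk h'.1
  exact fun m => hzero m (Or.inl (hzero i (Or.inr hij.symm)))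

theorem shearModule_span_kappa (hij : i ≠ j) :
    Submodule.span K[X] (Set.range (shearModule l α i j).kappa) = ⊤ := by
  refine span_kappa_eq_top _ fun k => ?_
  have hmem (k : Fin d) := Submodule.subset_span (R := K[X])
    (Set.mem_range_self (f := (shearModule l α i j).kappa) k)
  by_cases hk : k = i
  · subst hk
    rw [shearModule_motiveTau_kappa_self l α hij]
    exact Submodule.sub_mem _ (Submodule.smul_mem _ _ (hmem _)) (Submodule.smul_mem _ _ (hmem _))
  · rw [shearModule_motiveTau_kappa_of_ne l α hk]
    exact Submodule.smul_mem _ _ (hmem _)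

/-- The generators `κ_k` form a basis of the `t`-motive over `K[t]`. -/
def shearModuleBasis (hij : i ≠ j) :
    Module.Basis (Fin d) K[X] (shearModule l α i j).Motive :=
  Module.Basis.mk (shearModule_linearIndependent_kappa l α hij)
    (shearModule_span_kappa l α hij).ge

theorem shearModule_isAbelian (hij : i ≠ j) : (shearModule l α i j).IsAbelian :=
  Module.Finite.of_basis (shearModuleBasis l α hij)

theorem shearModule_weight (hij : i ≠ j) : (shearModule l α i j).weight = 1 := by
  have hd : (d : ℚ) ≠ 0 := Nat.cast_ne_zero.2 i.pos.ne'
  rw [weight, Module.finrank_eq_card_basis (shearModuleBasis l α hij), Fintype.card_fin,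
    div_self hd]

end Motive

/-! ### Frobenius twists and the embeddings of `K[t]` and `K[[1/t]]` in `K((1/t))`. -/

section Laurent

variable {Fq K : Type*} [Field Fq] [Fintype Fq] [Field K] [Algebra Fq K]

variable (Fq K) in
/-- The `q`-power Frobenius map on the coefficients of power series in `1/t`. -/
def powerSeriesTwist : K⟦X⟧ →+* K⟦X⟧ :=
  PowerSeries.map (FiniteField.frobeniusAlgHom Fq K : K →+* K)

/-- Since `q` is a power of the characteristic `p`, this map is an iterate of the `p`-power
Frobenius map, which is bijective on a perfect field. -/
theorem frobenius_surjective [PerfectField K] :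
    Function.Surjective (FiniteField.frobeniusAlgHom Fq K : K →+* K) := by
  obtain ⟨p, hp⟩ := CharP.exists Fq
  obtain ⟨n, hpp, hn⟩ := FiniteField.card Fq p
  have : Fact p.Prime := ⟨hpp⟩
  have : CharP K p := charP_of_injective_algebraMap (algebraMap Fq K).injective p
  have : ExpChar K p := ExpChar.prime hpp
  intro x
  obtain ⟨y, hy⟩ := (bijective_iterateFrobenius K p n).2 x
  refine ⟨y, ?_⟩
  rw [← hy, iterateFrobenius_def, ← hn]
  rfl

instance [PerfectField K] : RingHomSurjective (powerSeriesTwist Fq K) :=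
  ⟨PowerSeries.map_surjective _ frobenius_surjective⟩

theorem laurentTwist_algebraMap_powerSeries (f : K⟦X⟧) :
    laurentTwist Fq K (algebraMap K⟦X⟧ (LaurentInf K) f) =
      algebraMap K⟦X⟧ (LaurentInf K) (powerSeriesTwist Fq K f) := by
  refine HahnSeries.ext (funext fun n => ?_)
  change (FiniteField.frobeniusAlgHom Fq K : K →+* K) ((f : LaurentSeries K).coeff n) =
    ((powerSeriesTwist Fq K f : K⟦X⟧) : LaurentSeries K).coeff n
  rw [PowerSeries.coeff_coe, PowerSeries.coeff_coe]
  split_ifs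
  · exact map_zero _
  · rw [powerSeriesTwist, PowerSeries.coeff_map]

namespace LaurentInf

theorem algebraMap_C (a : K) : algebraMap K[X] (LaurentInf K) (Polynomial.C a) =
    algebraMap K⟦X⟧ (LaurentInf K) (PowerSeries.C a) :=
  (Polynomial.eval₂_C (LaurentInf.C K) (LaurentInf.t K)).trans
    (HahnSeries.ofPowerSeries_C a).symm

theorem algebraMap_polynomial_X : algebraMap K[X] (LaurentInf K) Polynomial.X = t K :=
  Polynomial.eval₂_X (LaurentInf.C K) (LaurentInf.t K)

theorem t_mul_algebraMap_X : t K * algebraMap K⟦X⟧ (LaurentInf K) PowerSeries.X = 1 := by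
  have h : algebraMap K⟦X⟧ (LaurentInf K) PowerSeries.X =
    (HahnSeries.single (1 : ℤ) (1 : K) : LaurentSeries K) := HahnSeries.ofPowerSeries_X
  rw [h]
  refine (HahnSeries.single_mul_single (R := K) (a := (-1 : ℤ)) (b := 1) (r := 1) (s := 1)).trans ?_
  simp
  rfl

theorem t_ne_zero : t K ≠ 0 := left_ne_zero_of_mul_eq_one t_mul_algebraMap_X

/-- Writes `t - a` as `t` times the unit `1 - a / t` of `K[[1/t]]`. -/
theorem algebraMap_X_sub_C (a : K) :
    algebraMap K[X] (LaurentInf K) (Polynomial.X - Polynomial.C a) =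
      algebraMap K⟦X⟧ (LaurentInf K) (1 - PowerSeries.C a * PowerSeries.X) * t K := by
  rw [map_sub, map_sub, algebraMap_C, algebraMap_polynomial_X, map_mul, map_one, sub_mul,
    one_mul, mul_assoc, mul_comm _ (t K), t_mul_algebraMap_X, mul_one]

end LaurentInf

theorem laurentTwist_t : laurentTwist Fq K (LaurentInf.t K) = LaurentInf.t K := by
  rw [← LaurentInf.algebraMap_polynomial_X, laurentTwist_algebraMap]
  simp [TModule.polyTwist]

end Laurent

/-! ### A lattice criterion for purity of weight `1`. -/

namespace TModule

variable {Fq K : Type*} [Field Fq] [Fintype Fq] [Field K] [Algebra Fq K]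
variable {l : Fq[X] →ₐ[Fq] K} {d : ℕ} (E : TModule l d)

theorem tauInf_smul (c : LaurentInf K) (x : E.MotiveInf) :
    E.tauInf (c • x) = laurentTwist Fq K c • E.tauInf x := by
  induction x using TensorProduct.induction_on with
  | zero => simp
  | add x y hx hy => rw [smul_add, map_add, hx, hy, map_add, smul_add]
  | tmul f m =>
    rw [TensorProduct.smul_tmul', tauInf_tmul, tauInf_tmul, TensorProduct.smul_tmul',
      smul_eq_mul, smul_eq_mul, map_mul]

/-- The action of `τ` on `K((1/t)) ⊗ M(E)`, as a map semilinear over `K[[1/t]]`. -/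
def tauInfPowerSeries : E.MotiveInf →ₛₗ[powerSeriesTwist Fq K] E.MotiveInf where
  toFun := E.tauInf
  map_add' := map_add _
  map_smul' f x := by
    rw [← algebraMap_smul (LaurentInf K) f x, tauInf_smul, laurentTwist_algebraMap_powerSeries,
      algebraMap_smul]

theorem tmul_smul_motive (f : LaurentInf K) (p : K[X]) (m : E.Motive) :
    (f ⊗ₜ (p • m) : E.MotiveInf) = algebraMap K[X] (LaurentInf K) p • (f ⊗ₜ m) := by
  rw [TensorProduct.tmul_smul, algebraMap_smul]

/-- A criterion for purity of weight `1`: a `K[[1/t]]`-lattice spanned by vectors `c_k ⊗ κ_k`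
such that `t` and `τ` multiply it to the same lattice. -/
theorem isPure_of_span_eq [PerfectField K] (hab : E.IsAbelian)
    (hspan : Submodule.span K[X] (Set.range E.kappa) = ⊤)
    (c : Fin d → LaurentInf K) (hc : ∀ k, c k ≠ 0)
    (h : Submodule.span K⟦X⟧ (Set.range fun k =>
        LaurentInf.t K • (c k ⊗ₜ E.kappa k : E.MotiveInf)) =
      Submodule.span K⟦X⟧ (Set.range fun k => E.tauInf (c k ⊗ₜ E.kappa k))) :
    E.IsPure := by
  set e : Fin d → E.MotiveInf := fun k => c k ⊗ₜ E.kappa k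
  refine ⟨hab, Submodule.span K⟦X⟧ (Set.range e), ⟨Submodule.fg_span (Set.finite_range e), ?_⟩,
    1, 1, one_pos, one_pos, ?_⟩
  · set S := Submodule.span (LaurentInf K)
      (Submodule.span K⟦X⟧ (Set.range e) : Set E.MotiveInf)
    -- Each `c k` is invertible in `K((1/t))`, so the span contains `1 ⊗ κ_k`, hence every `1 ⊗ m`.
    have hone : ∀ m : E.Motive, (1 ⊗ₜ m : E.MotiveInf) ∈ S := by
      have hle : Submodule.span K[X] (Set.range E.kappa) ≤
          (S.restrictScalars K[X]).comap (TensorProduct.mk K[X] (LaurentInf K) E.Motive 1) := by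
        refine Submodule.span_le.2 ?_
        rintro _ ⟨k, rfl⟩
        have h1 : e k ∈ S := Submodule.subset_span (Submodule.subset_span ⟨k, rfl⟩)
        have h2 := S.smul_mem (c k)⁻¹ h1
        rw [TensorProduct.smul_tmul', smul_eq_mul, inv_mul_cancel₀ (hc k)] at h2
        exact h2
      intro m
      exact hle (hspan ▸ Submodule.mem_top)
    refine eq_top_iff.2 fun x _ => ?_
    induction x using TensorProduct.induction_on with
    | zero => exact S.zero_mem
    | add x y hx hy => exact S.add_mem (hx trivial) (hy trivial)
    | tmul f m =>
      have := S.smul_mem f (hone m)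
      rwa [TensorProduct.smul_tmul', smul_eq_mul, mul_one] at this
  · let tLin : E.MotiveInf →ₗ[K⟦X⟧] E.MotiveInf :=
      (LinearMap.lsmul (LaurentInf K) E.MotiveInf (LaurentInf.t K)).restrictScalars K⟦X⟧
    have h1 : (Submodule.span K⟦X⟧ (Set.range e)).map tLin =
        (Submodule.span K⟦X⟧ (Set.range e)).map E.tauInfPowerSeries := by
      -- For the semilinear `τ`, the image of a span is the span of the images because the twist of
      -- `K[[1/t]]` is surjective; perfectness of `K` enters here.
      rw [Submodule.map_span, Submodule.map_span, ← Set.range_comp, ← Set.range_comp]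
      exact h
    have h2 := congrArg (fun N : Submodule K⟦X⟧ E.MotiveInf => (N : Set E.MotiveInf)) h1
    simp only [pow_one, Function.iterate_one]
    exact h2

end TModule

/-! ### Purity of the shear module. -/

section Shear

open TModule

variable {Fq K : Type*} [Field Fq] [Fintype Fq] [Field K] [Algebra Fq K]
variable (l : Fq[X] →ₐ[Fq] K) {d : ℕ} (α : K) {i j : Fin d}

/-- The transition matrix is triangular with the unit `u` on the diagonal: `v j` is recovered from
`w j`, as `j ≠ i`, and then `v i` from `w i`. -/
theorem span_range_eq_of_transvection {R V ι : Type*} [CommRing R] [AddCommGroup V] [Module R V]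
    {i j : ι} (hij : i ≠ j) {u b : R} (hu : IsUnit u) {v w : ι → V}
    (hne : ∀ k, k ≠ i → w k = u • v k) (hi : w i = u • v i - b • v j) :
    Submodule.span R (Set.range v) = Submodule.span R (Set.range w) := by
  refine le_antisymm (Submodule.span_le.2 ?_) (Submodule.span_le.2 ?_)
  · set S := Submodule.span R (Set.range w)
    have hmem (k) : w k ∈ S := Submodule.subset_span ⟨k, rfl⟩
    have hv (k) (hk : k ≠ i) : v k ∈ S :=
      (S.smul_mem_iff_of_isUnit hu).1 (hne k hk ▸ hmem k)
    rintro _ ⟨k, rfl⟩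
    by_cases hk : k = i
    · subst hk
      refine (S.smul_mem_iff_of_isUnit hu).1 ?_
      rw [sub_eq_iff_eq_add.1 hi.symm]
      exact S.add_mem (hmem k) (S.smul_mem _ (hv j hij.symm))
    · exact hv k hk
  · set S := Submodule.span R (Set.range v)
    have hmem (k) : v k ∈ S := Submodule.subset_span ⟨k, rfl⟩
    rintro _ ⟨k, rfl⟩
    by_cases hk : k = i
    · subst hk
      rw [hi]
      exact S.sub_mem (S.smul_mem _ (hmem k)) (S.smul_mem _ (hmem j))
    · rw [hne k hk]
      exact S.smul_mem _ (hmem k)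

theorem shearModule_isPure [PerfectField K] (hij : i ≠ j) : (shearModule l α i j).IsPure := by
  set E := shearModule l α i j
  -- The lattice is spanned by `t κ_j` and the other `κ_k`. The extra factor `t` lowers the
  -- coefficient of degree `2` in `τ κ_i` to degree `1`, matching multiplication by `t`.
  set c : Fin d → LaurentInf K := fun k => if k = j then LaurentInf.t K else 1
  set e : Fin d → E.MotiveInf := fun k => LaurentInf.t K • (c k ⊗ₜ E.kappa k)
  set u : K → K⟦X⟧ := fun b => 1 - PowerSeries.C b * PowerSeries.X
  have hu : IsUnit (u (l Polynomial.X)) := by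
    rw [PowerSeries.isUnit_iff_constantCoeff]
    simp [u]
  have hc0 (k) : c k ≠ 0 := by
    simp only [c]
    split_ifs
    exacts [LaurentInf.t_ne_zero, one_ne_zero]
  have hc (k) : laurentTwist Fq K (c k) = c k := by
    simp only [c]
    split_ifs
    exacts [laurentTwist_t, map_one _]
  have hX (f : LaurentInf K) (b : K) (m : E.Motive) :
      (f ⊗ₜ ((Polynomial.X - Polynomial.C b) • m) : E.MotiveInf) =
        u b • LaurentInf.t K • (f ⊗ₜ m) := by
    rw [tmul_smul_motive, LaurentInf.algebraMap_X_sub_C, mul_smul, algebraMap_smul]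
  have hne (k) (hk : k ≠ i) : E.tauInf (c k ⊗ₜ E.kappa k) = u (l Polynomial.X) • e k := by
    rw [tauInf_tmul, hc, shearModule_motiveTau_kappa_of_ne l α hk, hX]
  have hi : E.tauInf (c i ⊗ₜ E.kappa i) = u (l Polynomial.X) • e i -
      (PowerSeries.C α * u (l Polynomial.X ^ Fintype.card Fq) * u (l Polynomial.X)) • e j := by
    -- As `c j = t` and `c i = 1`, `e j` carries `t²`, which the two linear factors of the quadratic
    -- term supply.
    have hej : e j = LaurentInf.t K • LaurentInf.t K • (c i ⊗ₜ E.kappa j) := by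
      simp only [e, c, if_true, if_neg hij]
      rw [TensorProduct.smul_tmul' _ (1 : LaurentInf K), smul_eq_mul, mul_one]
    rw [tauInf_tmul, hc, shearModule_motiveTau_kappa_self l α hij, TensorProduct.tmul_sub, hX,
      hej, mul_assoc, mul_smul, mul_smul, tmul_smul_motive, LaurentInf.algebraMap_C,
      algebraMap_smul, hX, hX, mul_smul, mul_smul, smul_comm (LaurentInf.t K) (u _)]
  exact isPure_of_span_eq E (shearModule_isAbelian l α hij) (shearModule_span_kappa l α hij)
    c hc0 (span_range_eq_of_transvection hij hu hne hi)

end Shear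

end TMod

end

theorem theorem4 {Fq K : Type*} [Field Fq] [Fintype Fq] [Field K] [Algebra Fq K]
    [PerfectField K] (l : Polynomial Fq →ₐ[Fq] K) :
    (¬ Algebra.IsAlgebraic Fq K →
      ∀ d : ℕ, 2 ≤ d → ∃ E : TMod.TModule l d, E.IsPure ∧ ¬ E.IsAlmostStrictlyPure) ∧
    (Transcendental Fq (l Polynomial.X) →
      (∃ E : TMod.TModule l 2, E.D = TMod.exampleTwo Fq (l Polynomial.X) ∧
        E.IsPure ∧ E.weight = 1 ∧ ¬ E.IsAlmostStrictlyPure ∧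
        ∀ n : ℕ, 1 ≤ n → ∀ L : Matrix (Fin 2) (Fin 2) K,
          TMod.IsLeadingCoeff (TMod.exampleTwo Fq (l Polynomial.X) ^ n) L → ¬ IsUnit L) ∧
      ∀ m : ℕ, 1 ≤ m →
        ∃ E : TMod.TModule l (2 + m), E.D = TMod.exampleBlock Fq (l Polynomial.X) m ∧
          E.IsPure ∧ E.weight = 1 ∧ ¬ E.IsAlmostStrictlyPure) := by
  refine ⟨fun hK d hd => ?_, fun hθ => ⟨?_, fun m _ => ?_⟩⟩
  -- Here `α` is any element transcendental over `Fq`; it need not be related to `θ`, which may be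
  -- algebraic.
  · obtain ⟨α, hα⟩ := not_forall.1 fun h => hK ⟨h⟩
    have hij : (⟨1, hd⟩ : Fin d) ≠ ⟨0, by omega⟩ := by simp
    exact ⟨TMod.shearModule l α _ _, TMod.shearModule_isPure l α hij,
      TMod.shearModule_not_isAlmostStrictlyPure l hα hij⟩
  · have hij : (1 : Fin 2) ≠ 0 := one_ne_zero
    refine ⟨TMod.shearModule l (l Polynomial.X) 1 0,
      (TMod.shearModule_D l _ _ _).trans (TMod.exampleTwo_eq_shearMatrix _).symm,
      TMod.shearModule_isPure l _ hij, TMod.shearModule_weight l _ hij,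
      TMod.shearModule_not_isAlmostStrictlyPure l hθ hij, ?_⟩
    rintro n hn L ⟨r, A, h, rfl, -⟩
    rw [TMod.exampleTwo_eq_shearMatrix] at h
    exact TMod.not_isUnit_of_shearMatrix_pow_eq_tauExpansion hθ hij hn h
  · have hij : Fin.castAdd m (1 : Fin 2) ≠ Fin.castAdd m (0 : Fin 2) := by
      simp [Fin.ext_iff]
    exact ⟨TMod.shearModule l (l Polynomial.X) _ _,
      (TMod.shearModule_D l _ _ _).trans (TMod.exampleBlock_eq_shearMatrix _ m).symm,
      TMod.shearModule_isPure l _ hij, TMod.shearModule_weight l _ hij,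
      TMod.shearModule_not_isAlmostStrictlyPure l hθ hij⟩
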